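/- **Theorem (Relative characterization).** Let $K$ be an arbitrary set and let $\Lambda$ be a restorative similarity type, i.e. a subset of the set of six unary connectives $\{\smile,\ \frown,\ \circ_\smile,\ \circ_\frown,\ \bullet_\smile,\ \bullet_\frown\}$. Let $\mathcal L_\Lambda$ be the set of formulas $$\phi ::= p_k \mid \top \mid \bot \mid \phi\wedge\phi \mid \phi\vee\phi \mid \star\phi \qquad (k\in K,\ \star\in\Lambda).$$ The Kripke signature has a binary predicate symbol $\mathbf R$ and a unary predicate symbol $\mathbf P_k$ for each $k\in K$; its (nonempty) first-order structures are the Kripke models $\mathfrak M=\langle W,R,\{P_k\}_{k\in K}\rangle$. The standard translation $\mathrm{st}(x,\phi)$ of $\phi\in\mathcal L_\Lambda$ is the first-order formula (with equality) in the free variable $x$ given by $\mathrm{st}(x,p_k)=\mathbf P_kx$, $\mathrm{st}(x,\top)=(x=x)$, $\mathrm{st}(x,\bot)=\neg(x=x)$, $\mathrm{st}(x,\phi\wedge\psi)=\mathrm{st}(x,\phi)\wedge\mathrm{st}(x,\psi)$, $\mathrm{st}(x,\phi\vee\psi)=\mathrm{st}(x,\phi)\vee\mathrm{st}(x,\psi)$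 and, with $y$ a fresh variable, $$\begin{aligned} \mathrm{st}(x,\smile\phi)&=\exists y(x\mathbf Ry\wedge\neg\,\mathrm{st}(y,\phi)), & \mathrm{st}(x,\frown\phi)&=\forall y(x\mathbf Ry\to\neg\,\mathrm{st}(y,\phi)),\\ \mathrm{st}(x,\circ_\smile\phi)&=\neg\,\mathrm{st}(x,\phi)\vee\forall y(x\mathbf Ry\to\mathrm{st}(y,\phi)), & \mathrm{st}(x,\circ_\frown\phi)&=\mathrm{st}(x,\phi)\vee\forall y(x\mathbf Ry\to\neg\,\mathrm{st}(y,\phi)),\\ \mathrm{st}(x,\bullet_\smile\phi)&=\mathrm{st}(x,\phi)\wedge\exists y(x\mathbf Ry\wedge\neg\,\mathrm{st}(y,\phi)), & \mathrm{st}(x,\bullet_\frown\phi)&=\neg\,\mathrm{st}(x,\phi)\wedge\exists y(x\mathbf Ry\wedge\mathrm{st}(y,\phi)). \end{aligned}$$ A $\Lambda$-simulation on a Kripke model $\langle W,R,\{P_k\}_{k\in K}\rangle$ is a relation $S\subseteq W\times W$ such that $wSv$ and $w\in P_k$ imply $v\in P_k$ for every $k\in K$, and such that the following condition holds for each connective belonging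 to $\Lambda$ (for all $w,v,s,t\in W$): * $\smile$: if $wSv$ and $wRs$, then there is $t$ with $vRt$ and $tSs$; * $\frown$: if $wSv$ and $vRt$, then there is $s$ with $wRs$ and $tSs$; * $\circ_\smile$: if $wSv$ and $vRt$, then either $vSt$, or both $vSw$ and there is $s$ with $wRs$ and $sSt$; * $\circ_\frown$: if $wSv$ and $vRt$, then either $tSv$, or there is $s$ with $wRs$ and $tSs$; * $\bullet_\smile$: if $wSv$ and $wRs$, then either $wSs$, or there is $t$ with $vRt$ and $tSs$; * $\bullet_\frown$: if $wSv$ and $wRs$, then either $sSw$, or both $vSw$ and there is $t$ with $vRt$ and $sSt$. A $\Lambda$-simulation between Kripke models $\mathfrak M$ and $\mathfrak M'$ is a $\Lambda$-simulation on their disjoint union $\mathfrak M\uplus\mathfrak M'$. A first-order formula $\alpha(x)$ over the Kripke signature in one free variable $x$ is preserved by $\Lambda$-simulations if, for all Kripke models $\mathfrak M,\mathfrak M'$, every $\Lambda$-simulation $S$ between them, and all worlds $w$ of $\mathfrak M$ and $w'$ of $\mathfrak M'$ with $(w,w')\in S$ (as elements of the disjoint union), $\mathfrak M\Vdash\alpha(x)[w]$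 implies $\mathfrak M'\Vdash\alpha(x)[w']$. Let $\alpha(x)$ be a first-order formula over the Kripke signature in one free variable $x$. Then there is a formula $\phi\in\mathcal L_\Lambda$ such that $\alpha(x)$ and $\mathrm{st}(x,\phi)$ are logically equivalent (satisfied by the same worlds in all Kripke models) if and only if $\alpha(x)$ is preserved by $\Lambda$-simulations. -/

import Mathlib

universe u v

namespace Restorative

open FirstOrder FirstOrder.Language

/-- The six unary connectives: the two subclassical negations `smile` (⌣) and `frown` (⌢), and the
four restoration modalities, written with a white (`circ`) or a black (`bullet`) circle above
a smile or a frown. -/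
inductive Conn : Type
  | smile
  | frown
  | circSmile
  | circFrown
  | bulletSmile
  | bulletFrown

/-- The language `L_Λ` over the propositional letters `p_k` (`k : K`), for a restorative
similarity type `Λ`, that is, a set of the six connectives. -/
inductive ModalFormula (K : Type u) (Λ : Set Conn) : Type u
  | letter (k : K) : ModalFormula K Λ
  | top : ModalFormula K Λ
  | bot : ModalFormula K Λ
  | and (φ ψ : ModalFormula K Λ) : ModalFormula K Λ
  | or (φ ψ : ModalFormula K Λ) : ModalFormula K Λ
  | app (c : Conn) (hc : c ∈ Λ) (φ : ModalFormula K Λ) : ModalFormula K Λ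

/-- Kripke models with a nonempty set of worlds, an accessibility relation `Rel`, and a truth set
`Val k` for every propositional letter. -/
structure KripkeModel (K : Type u) where
  World : Type v
  nonempty : Nonempty World
  Rel : World → World → Prop
  Val : K → World → Prop

namespace KripkeModel

/-- The disjoint union of two Kripke models. -/
def disjUnion {K : Type u} (M N : KripkeModel.{u, v} K) : KripkeModel.{u, v} K where
  World := M.World ⊕ N.World
  nonempty := M.nonempty.map Sum.inl
  Rel
    | Sum.inl w, Sum.inl v => M.Rel w v
    | Sum.inr w, Sum.inr v => N.Rel w v
    | _, _ => False
  Val k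
    | Sum.inl w => M.Val k w
    | Sum.inr w => N.Val k w

end KripkeModel

/-- `S` is a `Λ`-simulation on the single Kripke model `M`. -/
structure IsSimulation {K : Type u} (Λ : Set Conn) (M : KripkeModel.{u, v} K)
    (S : M.World → M.World → Prop) : Prop where
  letter : ∀ k w v, S w v → M.Val k w → M.Val k v
  smile : Conn.smile ∈ Λ → ∀ w v s, S w v → M.Rel w s → ∃ t, M.Rel v t ∧ S t s
  frown : Conn.frown ∈ Λ → ∀ w v t, S w v → M.Rel v t → ∃ s, M.Rel w s ∧ S t s
  circSmile : Conn.circSmile ∈ Λ → ∀ w v t, S w v → M.Rel v t →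
    S v t ∨ (S v w ∧ ∃ s, M.Rel w s ∧ S s t)
  circFrown : Conn.circFrown ∈ Λ → ∀ w v t, S w v → M.Rel v t →
    S t v ∨ ∃ s, M.Rel w s ∧ S t s
  bulletSmile : Conn.bulletSmile ∈ Λ → ∀ w v s, S w v → M.Rel w s →
    S w s ∨ ∃ t, M.Rel v t ∧ S t s
  bulletFrown : Conn.bulletFrown ∈ Λ → ∀ w v s, S w v → M.Rel w s →
    S s w ∨ (S v w ∧ ∃ t, M.Rel v t ∧ S s t)

/-- A `Λ`-simulation between two Kripke models is a `Λ`-simulation on their disjoint union. -/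
def IsSimulationBetween {K : Type u} (Λ : Set Conn) (M N : KripkeModel.{u, v} K)
    (S : (M.disjUnion N).World → (M.disjUnion N).World → Prop) : Prop :=
  IsSimulation Λ (M.disjUnion N) S

/-- Relation symbols of the Kripke signature: a binary symbol `acc` and unary symbols `pred k`. -/
inductive KripkeRelation (K : Type u) : ℕ → Type u
  | acc : KripkeRelation K 2
  | pred (k : K) : KripkeRelation K 1

/-- The Kripke signature. -/
def kripkeLanguage (K : Type u) : FirstOrder.Language.{0, u} where
  Functions := fun _ => Empty
  Relations := KripkeRelation K

/-- The binary relation symbol of the Kripke signature. -/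
def accSymbol {K : Type u} : (kripkeLanguage K).Relations 2 := KripkeRelation.acc

/-- The unary relation symbols of the Kripke signature. -/
def predSymbol {K : Type u} (k : K) : (kripkeLanguage K).Relations 1 := KripkeRelation.pred k

/-- The first-order structure given by a Kripke model. -/
instance KripkeModel.toStructure {K : Type u} (M : KripkeModel.{u, v} K) :
    (kripkeLanguage K).Structure M.World where
  funMap := fun f _ => Empty.elim f
  RelMap := fun r xs =>
    match r, xs with
    | KripkeRelation.acc, xs => M.Rel (xs 0) (xs 1)
    | KripkeRelation.pred k, xs => M.Val k (xs 0)

/-- The atomic formula `x R y`. -/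
def accFormula {K : Type u} {V : Type} {n : ℕ} (x y : V ⊕ Fin n) :
    (kripkeLanguage K).BoundedFormula V n :=
  accSymbol.boundedFormula₂ (Term.var x) (Term.var y)

/-- The atomic formula `P_k x`. -/
def predFormula {K : Type u} {V : Type} {n : ℕ} (k : K) (x : V ⊕ Fin n) :
    (kripkeLanguage K).BoundedFormula V n :=
  (predSymbol k).boundedFormula₁ (Term.var x)

/-- The formula `x = x`. -/
def eqSelf {K : Type u} {V : Type} {n : ℕ} (x : V ⊕ Fin n) :
    (kripkeLanguage K).BoundedFormula V n :=
  Term.bdEqual (Term.var x) (Term.var x)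

/-- A variable, seen under one more quantifier. -/
def weaken {V : Type} {n : ℕ} : V ⊕ Fin n → V ⊕ Fin (n + 1) :=
  Sum.map id Fin.castSucc

/-- The variable bound by the innermost quantifier. -/
def fresh {V : Type} {n : ℕ} : V ⊕ Fin (n + 1) :=
  Sum.inr (Fin.last n)

/-- The standard translation `ST(x, φ)`. The variable `x` is either a free variable, in `V`, or one
of the `n` variables bound so far. -/
def st {K : Type u} {Λ : Set Conn} {V : Type} :
    {n : ℕ} → V ⊕ Fin n → ModalFormula K Λ → (kripkeLanguage K).BoundedFormula V n
  | _, x, .letter k => predFormula k x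
  | _, x, .top => eqSelf x
  | _, x, .bot => ∼(eqSelf x)
  | _, x, .and φ ψ => st x φ ⊓ st x ψ
  | _, x, .or φ ψ => st x φ ⊔ st x ψ
  | _, x, .app .smile _ φ => ∃' (accFormula (weaken x) fresh ⊓ ∼(st fresh φ))
  | _, x, .app .frown _ φ => ∀' (accFormula (weaken x) fresh ⟹ ∼(st fresh φ))
  | _, x, .app .circSmile _ φ =>
      ∼(st x φ) ⊔ ∀' (accFormula (weaken x) fresh ⟹ st fresh φ)
  | _, x, .app .circFrown _ φ =>
      st x φ ⊔ ∀' (accFormula (weaken x) fresh ⟹ ∼(st fresh φ))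
  | _, x, .app .bulletSmile _ φ =>
      st x φ ⊓ ∃' (accFormula (weaken x) fresh ⊓ ∼(st fresh φ))
  | _, x, .app .bulletFrown _ φ =>
      ∼(st x φ) ⊓ ∃' (accFormula (weaken x) fresh ⊓ st fresh φ)

/-- `M ⊩ α(x)[w]`, for a first-order formula `α` in one free variable. -/
def Holds {K : Type u} (M : KripkeModel.{u, v} K) (α : (kripkeLanguage K).Formula Unit)
    (w : M.World) : Prop :=
  α.Realize (fun _ : Unit => w)

/-- Logical equivalence of two first-order formulas in one free variable. -/
def Equivalent {K : Type u} (α β : (kripkeLanguage K).Formula Unit) : Prop :=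
  ∀ (M : KripkeModel.{u, v} K) (w : M.World), Holds M α w ↔ Holds M β w

/-- `α` is preserved by `Λ`-simulations between Kripke models. -/
def PreservedBySimulations {K : Type u} (Λ : Set Conn) (α : (kripkeLanguage K).Formula Unit) :
    Prop :=
  ∀ (M N : KripkeModel.{u, v} K) (S : (M.disjUnion N).World → (M.disjUnion N).World → Prop),
    IsSimulationBetween Λ M N S →
      ∀ (w : M.World) (w' : N.World), S (Sum.inl w) (Sum.inr w') → Holds M α w → Holds N α w'

end Restorative

/-!
Simulations preserve modal truth by induction on formulas, so a standard translation is preserved.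

Conversely, on an `ω`-saturated model inclusion of `L_Λ`-theories is itself a `Λ`-simulation, and
this survives disjoint unions. Every model has an `ω`-saturated elementary extension, the limit of a
chain of ultrapowers each of which realizes the types over its predecessor. Hence an `α` preserved
by simulations passes from `w` to `w'` whenever the theory of `w` is included in that of `w'`. If
now `w'` satisfies all modal consequences of `α`, then `α` is consistent with the negations of the
modal formulas failing at `w'`: a finite disjunction of these is not a consequence of `α`. So some
`w` satisfies `α` and has its theory included in that of `w'`, and `α` holds at `w'`. Thus `α`
follows from its modal consequences and, by compactness, is equivalent to a finite conjunction of
them.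
-/

namespace Restorative

open FirstOrder FirstOrder.Language Filter

universe w w'

section Saturation

variable {L : FirstOrder.Language.{u, v}}

theorem eventually_mem_ultrafilter {ι : Type*} (i : ι) :
    ∀ᶠ s in ((Ultrafilter.of atTop : Ultrafilter (Finset ι)) : Filter (Finset ι)), i ∈ s := by
  refine Ultrafilter.of_le atTop ?_
  filter_upwards [eventually_ge_atTop {i}] with s hs
  exact Finset.singleton_subset_iff.1 hs

theorem exists_realize_of_finset {ι : Type w} {α : Type*} (Φ : ι → L.Formula α)
    (h : ∀ s : Finset ι, ∃ (M : Type w') (_ : L.Structure M) (_ : Nonempty M) (x : α → M),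
      ∀ i ∈ s, (Φ i).Realize x) :
    ∃ (M : Type max w w') (_ : L.Structure M) (_ : Nonempty M) (x : α → M),
      ∀ i, (Φ i).Realize x := by
  choose M _ _ x hx using h
  refine ⟨((Ultrafilter.of atTop : Ultrafilter (Finset ι)) : Filter (Finset ι)).Product M,
    Ultraproduct.structure, inferInstance, _,
    fun i => (Ultraproduct.realize_formula_cast (Φ i) fun a s => x s a).2 ?_⟩
  exact (eventually_mem_ultrafilter i).mono fun s hs => hx s i hs

/-- The elementary embedding of a structure into its ultrapower, by constant sequences. -/
noncomputable def diagonalEmbedding (L : FirstOrder.Language.{u, v}) {I : Type*}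
    (U : Ultrafilter I) (M : Type*) [L.Structure M] [Nonempty M] :
    M ↪ₑ[L] (U : Filter I).Product fun _ => M where
  toFun a := ((fun _ => a : I → M) : (U : Filter I).Product fun _ => M)
  map_formula' _ φ x :=
    (Ultraproduct.realize_formula_cast φ fun i _ => x i).trans eventually_const

/-- Every 1-type over finitely many parameters of `M` that is finitely satisfiable in `M` is
realized in `N`, where parameters are sent along `f`. The parameters are substituted for the free
variables `Fin n` of a formula, and its remaining de Bruijn variable ranges over the realizations.
With `f = id` this is `ω`-saturation. -/
def RealizesTypesAlong (L : FirstOrder.Language.{u, v}) {M N : Type*} [L.Structure M]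
    [L.Structure N] (f : M → N) : Prop :=
  ∀ (n : ℕ) (a : Fin n → M) (p : Set (L.BoundedFormula (Fin n) 1)),
    (∀ s : Finset p, ∃ b : M, ∀ β ∈ s, β.1.Realize a fun _ => b) →
      ∃ b : N, ∀ β ∈ p, β.Realize (f ∘ a) fun _ => b

theorem realizesTypesAlong_diagonalEmbedding (M : Type*) [L.Structure M] [Nonempty M] :
    RealizesTypesAlong L (diagonalEmbedding L
      (Ultrafilter.of atTop : Ultrafilter (Finset (Σ n, L.BoundedFormula (Fin n) 1))) M) := by
  intro n a p hp
  have hinj : Function.Injective fun β : p => (⟨n, β⟩ : Σ n, L.BoundedFormula (Fin n) 1) :=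
    sigma_mk_injective.comp Subtype.val_injective
  choose b hb using fun s : Finset (Σ n, L.BoundedFormula (Fin n) 1) =>
    hp (s.preimage _ hinj.injOn)
  refine ⟨Quotient.mk _ b, fun β hβ =>
    (Ultraproduct.boundedFormula_realize_cast β (fun i _ => a i) fun _ => b).2 ?_⟩
  exact (eventually_mem_ultrafilter ⟨n, β⟩).mono fun s hs =>
    hb s ⟨β, hβ⟩ (Finset.mem_preimage.2 hs)

/-- `ω`-saturation: every finitely satisfiable 1-type over finitely many parameters is realized. -/
def IsOmegaSaturated (L : FirstOrder.Language.{u, v}) (M : Type*) [L.Structure M] : Prop :=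
  RealizesTypesAlong L (id : M → M)

theorem IsOmegaSaturated.exists_realize {M : Type*} [L.Structure M] (hM : IsOmegaSaturated L M)
    {ι : Type*} {n : ℕ} (Φ : ι → L.BoundedFormula (Fin n) 1) (a : Fin n → M)
    (h : ∀ s : Finset ι, ∃ b : M, ∀ i ∈ s, (Φ i).Realize a fun _ => b) :
    ∃ b : M, ∀ i, (Φ i).Realize a fun _ => b := by
  classical
  obtain ⟨b, hb⟩ := hM n a (Set.range Φ) fun s => by
    obtain ⟨b, hb⟩ := h (s.image fun β => β.2.choose)
    refine ⟨b, fun β hβ => ?_⟩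
    rw [← β.2.choose_spec]
    exact hb _ (Finset.mem_image_of_mem _ hβ)
  exact ⟨b, fun i => hb _ ⟨i, rfl⟩⟩

theorem realize_ex_iInf {M : Type*} [L.Structure M] {ι α : Type*} [Finite ι]
    (Φ : ι → L.BoundedFormula α 1) (x : α → M) :
    Formula.Realize (BoundedFormula.iInf Φ).ex x ↔ ∃ b : M, ∀ i, (Φ i).Realize x fun _ => b := by
  have snoc_default (b : M) : Fin.snoc default b = fun _ : Fin 1 => b :=
    funext fun i => by simp [Fin.fin_one_eq_zero i, Fin.snoc]
  simp only [Formula.Realize, BoundedFormula.realize_ex, BoundedFormula.realize_iInf, snoc_default]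

theorem exists_elementaryEmbedding_natLERec {G : ℕ → Type*} [∀ n, L.Structure (G n)]
    (f : ∀ n, G n ↪ₑ[L] G (n + 1)) {m n : ℕ} (h : m ≤ n) :
    ∃ g : G m ↪ₑ[L] G n,
      ⇑g = DirectedSystem.natLERec (fun n => (f n).toEmbedding) m n h := by
  induction n, h using Nat.le_induction with
  | base => exact ⟨.refl L _, funext fun x => by simp [Nat.leRecOn_self]⟩
  | succ n h ih =>
    obtain ⟨g, hg⟩ := ih
    exact ⟨(f n).comp g, funext fun x => by simp [hg, Nat.leRecOn_succ h]⟩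

section DirectLimit

variable {ι : Type*} [Preorder ι] [IsDirectedOrder ι] [Nonempty ι] {G : ι → Type*}
  [∀ i, L.Structure (G i)] {f : ∀ i j, i ≤ j → G i ↪[L] G j}
  [DirectedSystem G fun i j h => f i j h]

theorem realize_directLimit_of (hf : ∀ i j h, ∃ g : G i ↪ₑ[L] G j, ⇑g = f i j h) {α : Type*}
    {k : ℕ} (φ : L.BoundedFormula α k) (i : ι) (x : α → G i) (y : Fin k → G i) :
    φ.Realize (DirectLimit.of L ι G f i ∘ x) (DirectLimit.of L ι G f i ∘ y) ↔
      φ.Realize x y := by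
  induction φ generalizing i with
  | falsum => rfl
  | equal t₁ t₂ => exact (BoundedFormula.IsAtomic.equal t₁ t₂).isQF.realize_embedding _
  | rel R ts => exact (BoundedFormula.IsAtomic.rel R ts).isQF.realize_embedding _
  | imp φ ψ ih₁ ih₂ => simp only [BoundedFormula.Realize, ih₁, ih₂]
  | all φ ih =>
    simp only [BoundedFormula.Realize]
    refine ⟨fun h a => ?_, fun h z => ?_⟩
    · rw [← ih i, Fin.comp_snoc]
      exact h _
    · obtain ⟨j, a, rfl⟩ := DirectLimit.exists_of z
      obtain ⟨l, hil, hjl⟩ := directed_of (· ≤ ·) i j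
      obtain ⟨g, hg⟩ := hf i l hil
      have of_comp : DirectLimit.of L ι G f i = DirectLimit.of L ι G f l ∘ g := by
        rw [hg]
        exact funext fun b => (DirectLimit.of_f (hij := hil)).symm
      rw [of_comp, Function.comp_assoc, Function.comp_assoc, ← DirectLimit.of_f (hij := hjl),
        ← Fin.comp_snoc, ih l]
      exact (g.map_boundedFormula φ.all x y).2 h _

/-- The embedding of a member of an elementary directed system into the direct limit is
elementary. -/
noncomputable def directLimitOf (hf : ∀ i j h, ∃ g : G i ↪ₑ[L] G j, ⇑g = f i j h) (i : ι) :
    G i ↪ₑ[L] Language.DirectLimit G f where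
  toFun := DirectLimit.of L ι G f i
  map_formula' n φ x := by
    rw [Formula.Realize, Formula.Realize, ← realize_directLimit_of hf φ i x default]
    exact iff_of_eq (congrArg _ (Subsingleton.elim _ _))

end DirectLimit

section ElementaryChain

variable {G : ℕ → Type*} [∀ n, L.Structure (G n)] (f : ∀ n, G n ↪ₑ[L] G (n + 1))

theorem directLimit_of_succ (n : ℕ) :
    DirectLimit.of L ℕ G (DirectedSystem.natLERec fun n => (f n).toEmbedding) (n + 1) ∘ f n =
      DirectLimit.of L ℕ G (DirectedSystem.natLERec fun n => (f n).toEmbedding) n := by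
  funext a
  rw [← DirectLimit.of_f (hij := n.le_succ) (x := a), DirectedSystem.coe_natLERec]
  exact congrArg _ (Nat.leRecOn_succ' (C := G) (next := @fun k => f k) a).symm

theorem isOmegaSaturated_directLimit (hf : ∀ n, RealizesTypesAlong L (f n)) :
    IsOmegaSaturated L
      (Language.DirectLimit G (DirectedSystem.natLERec fun n => (f n).toEmbedding)) := by
  intro n c p hp
  have elementary {i j} (h : i ≤ j) := exists_elementaryEmbedding_natLERec f h
  obtain ⟨i, a, rfl⟩ : ∃ i a, c = directLimitOf (fun _ _ => elementary) i ∘ a :=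
    DirectLimit.exists_quotient_mk'_sigma_mk'_eq G _ c
  obtain ⟨b, hb⟩ := hf i n a p fun s => by
    obtain ⟨d, hd⟩ := hp s
    have := (realize_ex_iInf (fun β : s => β.1.1) _).2 ⟨d, fun β => hd β β.2⟩
    obtain ⟨b, hb⟩ := (realize_ex_iInf _ a).1 ((ElementaryEmbedding.map_formula _ _ a).1 this)
    exact ⟨b, fun β hβ => hb ⟨β, hβ⟩⟩
  refine ⟨directLimitOf (fun _ _ => elementary) (i + 1) b, fun β hβ => ?_⟩
  change β.Realize (DirectLimit.of L ℕ G _ i ∘ a) _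
  rw [← directLimit_of_succ f i, Function.comp_assoc]
  exact (realize_directLimit_of (fun _ _ => elementary) β (i + 1) _ fun _ => b).2 (hb β hβ)

end ElementaryChain

theorem exists_elementary_chain (M : Type max u v w) [L.Structure M] [Nonempty M] :
    ∃ (G : ℕ → Type max u v w) (_ : ∀ n, L.Structure (G n)) (f : ∀ n, G n ↪ₑ[L] G (n + 1)),
      Nonempty (M ↪ₑ[L] G 0) ∧ ∀ n, RealizesTypesAlong L (f n) := by
  have extend (A : CategoryTheory.Bundled.{max u v w} L.Structure) (_ : Nonempty A) :
      ∃ (B : CategoryTheory.Bundled.{max u v w} L.Structure) (f : A ↪ₑ[L] B),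
        RealizesTypesAlong L f :=
    ⟨⟨_, _⟩, _, realizesTypesAlong_diagonalEmbedding A⟩
  choose B f hf using extend
  let C : ℕ → {A : CategoryTheory.Bundled.{max u v w} L.Structure // Nonempty A} :=
    Nat.rec ⟨⟨M, inferInstance⟩, inferInstance⟩ fun _ A => ⟨B A.1 A.2, A.2.map (f A.1 A.2)⟩
  exact ⟨fun n => (C n).1, fun n => (C n).1.str, fun n => f (C n).1 (C n).2, ⟨.refl L M⟩,
    fun n => hf (C n).1 (C n).2⟩

theorem exists_isOmegaSaturated (M : Type max u v w) [L.Structure M] [Nonempty M] :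
    ∃ (N : Type max u v w) (_ : L.Structure N), Nonempty (M ↪ₑ[L] N) ∧ IsOmegaSaturated L N := by
  obtain ⟨G, _, f, ⟨g⟩, hf⟩ := exists_elementary_chain.{u, v, w} (L := L) M
  exact ⟨_, _, ⟨(directLimitOf (fun _ _ => exists_elementaryEmbedding_natLERec f) 0).comp g⟩,
    isOmegaSaturated_directLimit f hf⟩

end Saturation

section Semantics

variable {K : Type u} {Λ : Set Conn}

/-- The relational semantics of `L_Λ`. -/
def Sat (M : KripkeModel.{u, v} K) : M.World → ModalFormula K Λ → Prop
  | w, .letter k => M.Val k w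
  | _, .top => True
  | _, .bot => False
  | w, .and φ ψ => Sat M w φ ∧ Sat M w ψ
  | w, .or φ ψ => Sat M w φ ∨ Sat M w ψ
  | w, .app .smile _ φ => ∃ s, M.Rel w s ∧ ¬ Sat M s φ
  | w, .app .frown _ φ => ∀ s, M.Rel w s → ¬ Sat M s φ
  | w, .app .circSmile _ φ => ¬ Sat M w φ ∨ ∀ s, M.Rel w s → Sat M s φ
  | w, .app .circFrown _ φ => Sat M w φ ∨ ∀ s, M.Rel w s → ¬ Sat M s φ
  | w, .app .bulletSmile _ φ => Sat M w φ ∧ ∃ s, M.Rel w s ∧ ¬ Sat M s φ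
  | w, .app .bulletFrown _ φ => ¬ Sat M w φ ∧ ∃ s, M.Rel w s ∧ Sat M s φ

theorem realize_accFormula (M : KripkeModel.{u, v} K) {V : Type} {n : ℕ} (x y : V ⊕ Fin n)
    (a : V → M.World) (b : Fin n → M.World) :
    (accFormula (K := K) x y).Realize a b ↔ M.Rel (Sum.elim a b x) (Sum.elim a b y) :=
  BoundedFormula.realize_rel₂

theorem realize_predFormula (M : KripkeModel.{u, v} K) {V : Type} {n : ℕ} (k : K)
    (x : V ⊕ Fin n) (a : V → M.World) (b : Fin n → M.World) :
    (predFormula k x).Realize a b ↔ M.Val k (Sum.elim a b x) :=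
  BoundedFormula.realize_rel₁

theorem elim_weaken {W : Type*} {V : Type} {n : ℕ} (x : V ⊕ Fin n) (a : V → W) (b : Fin n → W)
    (c : W) : Sum.elim a (Fin.snoc b c : Fin (n + 1) → W) (weaken x) = Sum.elim a b x := by
  cases x <;> simp [weaken]

theorem elim_fresh {W : Type*} {V : Type} {n : ℕ} (a : V → W) (b : Fin n → W) (c : W) :
    Sum.elim a (Fin.snoc b c : Fin (n + 1) → W) (fresh : V ⊕ Fin (n + 1)) = c := by
  simp [fresh]

theorem realize_st (M : KripkeModel.{u, v} K) {V : Type} (φ : ModalFormula K Λ) {n : ℕ}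
    (x : V ⊕ Fin n) (a : V → M.World) (b : Fin n → M.World) :
    (st x φ).Realize a b ↔ Sat M (Sum.elim a b x) φ := by
  induction φ generalizing n with
  | letter k => exact realize_predFormula M k x a b
  | top => simp [st, Sat, eqSelf]
  | bot => simp [st, Sat, eqSelf]
  | and φ ψ ih₁ ih₂ => simp [st, Sat, ih₁, ih₂]
  | or φ ψ ih₁ ih₂ => simp [st, Sat, ih₁, ih₂]
  | app c hc φ ih =>
    cases c <;> simp [st, Sat, ih, realize_accFormula, elim_weaken, elim_fresh]

theorem holds_st (M : KripkeModel.{u, v} K) (φ : ModalFormula K Λ) (w : M.World) :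
    Holds M (st (Sum.inl ()) φ) w ↔ Sat M w φ :=
  realize_st M φ _ _ _

/-- Finite conjunctions in `L_Λ`. The order of the conjuncts is arbitrary. -/
noncomputable def ModalFormula.conj {ι : Type*} (s : Finset ι) (χ : ι → ModalFormula K Λ) :
    ModalFormula K Λ :=
  (s.toList.map χ).foldr .and .top

/-- Finite disjunctions in `L_Λ`. The order of the disjuncts is arbitrary. -/
noncomputable def ModalFormula.disj {ι : Type*} (s : Finset ι) (χ : ι → ModalFormula K Λ) :
    ModalFormula K Λ :=
  (s.toList.map χ).foldr .or .bot

section FiniteConnectives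

variable {ι : Type*} {s : Finset ι} {χ : ι → ModalFormula K Λ} {M : KripkeModel.{u, v} K}
  {w : M.World}

theorem sat_conj : Sat M w (.conj s χ) ↔ ∀ i ∈ s, Sat M w (χ i) := by
  simp only [← Finset.mem_toList, ModalFormula.conj]
  induction s.toList with
  | nil => simp [Sat]
  | cons i l ih => simp [Sat, ih]

theorem sat_disj : Sat M w (.disj s χ) ↔ ∃ i ∈ s, Sat M w (χ i) := by
  simp only [← Finset.mem_toList, ModalFormula.disj]
  induction s.toList with
  | nil => simp [Sat]
  | cons i l ih => simp [Sat, ih]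

end FiniteConnectives

/-- `L_Λ`-theory inclusion: every formula true at the world `w` of `M` is true at the world `v`
of `N`. -/
def TheoryLE (Λ : Set Conn) {M : KripkeModel.{u, v} K} {N : KripkeModel.{u, w} K} (w : M.World)
    (v : N.World) : Prop :=
  ∀ φ : ModalFormula K Λ, Sat M w φ → Sat N v φ

theorem exists_sat_not_sat_of_not_theoryLE {M : KripkeModel.{u, v} K} {N : KripkeModel.{u, w} K}
    {w : M.World} {v : N.World} (h : ¬ TheoryLE Λ w v) :
    ∃ φ : ModalFormula K Λ, Sat M w φ ∧ ¬ Sat N v φ := by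
  simpa only [TheoryLE, not_forall, exists_prop] using h

end Semantics

section BoundedMorphism

variable {K : Type u} {Λ : Set Conn}

/-- Bounded morphisms (also known as p-morphisms) of Kripke models. The back and forth conditions
are merged into the statement that the successors of `f w` are the images of those of `w`. -/
structure IsBoundedMorphism (M : KripkeModel.{u, v} K) (N : KripkeModel.{u, w} K)
    (f : M.World → N.World) : Prop where
  val : ∀ k w, N.Val k (f w) ↔ M.Val k w
  rel : ∀ w t, N.Rel (f w) t ↔ ∃ s, M.Rel w s ∧ f s = t

theorem IsBoundedMorphism.sat_iff {M : KripkeModel.{u, v} K} {N : KripkeModel.{u, w} K}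
    {f : M.World → N.World} (hf : IsBoundedMorphism M N f) (φ : ModalFormula K Λ) (w : M.World) :
    Sat N (f w) φ ↔ Sat M w φ := by
  induction φ generalizing w with
  | letter k => exact hf.val k w
  | top => rfl
  | bot => rfl
  | and φ ψ ih₁ ih₂ => simp only [Sat, ih₁, ih₂]
  | or φ ψ ih₁ ih₂ => simp only [Sat, ih₁, ih₂]
  | app c hc φ ih =>
    cases c <;> simp only [Sat, hf.rel, ih, exists_exists_and_eq_and, forall_exists_index, and_imp,
      forall_apply_eq_imp_iff₂]

variable (M N : KripkeModel.{u, v} K)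

theorem isBoundedMorphism_inl : IsBoundedMorphism M (M.disjUnion N) Sum.inl where
  val _ _ := Iff.rfl
  rel _ t := by cases t <;> simp [KripkeModel.disjUnion]

theorem isBoundedMorphism_inr : IsBoundedMorphism N (M.disjUnion N) Sum.inr where
  val _ _ := Iff.rfl
  rel _ t := by cases t <;> simp [KripkeModel.disjUnion]

theorem theoryLE_inl_inr_iff {w : M.World} {v : N.World} :
    TheoryLE Λ (M := M.disjUnion N) (N := M.disjUnion N) (Sum.inl w) (Sum.inr v) ↔
      TheoryLE Λ w v := by
  simp only [TheoryLE, (isBoundedMorphism_inl M N).sat_iff, (isBoundedMorphism_inr M N).sat_iff]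

end BoundedMorphism

section Simulation

variable {K : Type u} {Λ : Set Conn} {M : KripkeModel.{u, v} K} {S : M.World → M.World → Prop}

theorem IsSimulation.sat_app (hS : IsSimulation Λ M S) {c : Conn} {hc : c ∈ Λ}
    {φ : ModalFormula K Λ} (hφ : ∀ {w v}, S w v → Sat M w φ → Sat M v φ) {w v : M.World}
    (hwv : S w v) (h : Sat M w (.app c hc φ)) : Sat M v (.app c hc φ) := by
  cases c with
  | smile =>
    obtain ⟨s, hs, hsφ⟩ := h
    obtain ⟨t, ht, hts⟩ := hS.smile hc w v s hwv hs
    exact ⟨t, ht, mt (hφ hts) hsφ⟩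
  | frown =>
    intro t ht htφ
    obtain ⟨s, hs, hts⟩ := hS.frown hc w v t hwv ht
    exact h s hs (hφ hts htφ)
  | circSmile =>
    refine or_iff_not_imp_left.2 fun hv t ht => ?_
    rw [not_not] at hv
    obtain hvt | ⟨hvw, s, hs, hst⟩ := hS.circSmile hc w v t hwv ht
    · exact hφ hvt hv
    · exact hφ hst (h.resolve_left (not_not.2 (hφ hvw hv)) s hs)
  | circFrown =>
    refine or_iff_not_imp_left.2 fun hv t ht htφ => ?_
    obtain htv | ⟨s, hs, hts⟩ := hS.circFrown hc w v t hwv ht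
    · exact hv (hφ htv htφ)
    · exact h.resolve_left (mt (hφ hwv) hv) s hs (hφ hts htφ)
  | bulletSmile =>
    obtain ⟨hw, s, hs, hsφ⟩ := h
    refine ⟨hφ hwv hw, ?_⟩
    obtain hws | ⟨t, ht, hts⟩ := hS.bulletSmile hc w v s hwv hs
    · exact absurd (hφ hws hw) hsφ
    · exact ⟨t, ht, mt (hφ hts) hsφ⟩
  | bulletFrown =>
    obtain ⟨hw, s, hs, hsφ⟩ := h
    obtain hsw | ⟨hvw, t, ht, hst⟩ := hS.bulletFrown hc w v s hwv hs
    · exact absurd (hφ hsw hsφ) hw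
    · exact ⟨mt (hφ hvw) hw, t, ht, hφ hst hsφ⟩

theorem IsSimulation.theoryLE (hS : IsSimulation Λ M S) {w v : M.World} (hwv : S w v) :
    TheoryLE Λ w v := by
  intro φ h
  induction φ generalizing w v with
  | letter k => exact hS.letter k w v hwv h
  | top => trivial
  | bot => exact h
  | and φ ψ ih₁ ih₂ => exact ⟨ih₁ hwv h.1, ih₂ hwv h.2⟩
  | or φ ψ ih₁ ih₂ => exact h.imp (ih₁ hwv) (ih₂ hwv)
  | app c hc φ ih => exact hS.sat_app ih hwv h

end Simulation

section ModalSaturation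

variable {K : Type u} {Λ : Set Conn}

/-- Modal saturation at the world `w`. As `L_Λ` lacks classical negation, sets of formulas to be
verified and sets of formulas to be falsified at a common successor are treated separately. -/
structure IsModallySaturatedAt (Λ : Set Conn) (M : KripkeModel.{u, v} K) (w : M.World) :
    Prop where
  exists_verifying : ∀ T : Set (ModalFormula K Λ),
    (∀ s : Finset T, ∃ y, M.Rel w y ∧ ∀ χ ∈ s, Sat M y χ.1) →
      ∃ y, M.Rel w y ∧ ∀ χ ∈ T, Sat M y χ
  exists_falsifying : ∀ T : Set (ModalFormula K Λ),
    (∀ s : Finset T, ∃ y, M.Rel w y ∧ ∀ χ ∈ s, ¬ Sat M y χ.1) →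
      ∃ y, M.Rel w y ∧ ∀ χ ∈ T, ¬ Sat M y χ

/-- Modally saturated models, on which theory inclusion is a simulation. -/
def IsModallySaturated (Λ : Set Conn) (M : KripkeModel.{u, v} K) : Prop :=
  ∀ w, IsModallySaturatedAt Λ M w

theorem IsBoundedMorphism.isModallySaturatedAt {M : KripkeModel.{u, v} K}
    {N : KripkeModel.{u, w} K} {f : M.World → N.World} (hf : IsBoundedMorphism M N f)
    {w : M.World} (hw : IsModallySaturatedAt Λ M w) : IsModallySaturatedAt Λ N (f w) := by
  constructor <;> simp only [hf.rel, exists_exists_and_eq_and, hf.sat_iff]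
  exacts [hw.exists_verifying, hw.exists_falsifying]

theorem IsModallySaturated.disjUnion {M N : KripkeModel.{u, v} K} (hM : IsModallySaturated Λ M)
    (hN : IsModallySaturated Λ N) : IsModallySaturated Λ (M.disjUnion N)
  | .inl w => (isBoundedMorphism_inl M N).isModallySaturatedAt (hM w)
  | .inr w => (isBoundedMorphism_inr M N).isModallySaturatedAt (hN w)

variable {M : KripkeModel.{u, v} K} {w v s t : M.World}

theorem IsModallySaturatedAt.exists_theoryLE_of_sat (hw : IsModallySaturatedAt Λ M w)
    (h : ∀ χ : ModalFormula K Λ, Sat M t χ → ∃ s, M.Rel w s ∧ Sat M s χ) :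
    ∃ s, M.Rel w s ∧ TheoryLE Λ t s := by
  refine hw.exists_verifying {χ | Sat M t χ} fun T => ?_
  simp only [← sat_conj]
  exact h _ (sat_conj.2 fun χ _ => χ.2)

theorem IsModallySaturatedAt.exists_theoryLE_of_not_sat (hw : IsModallySaturatedAt Λ M w)
    (h : ∀ χ : ModalFormula K Λ, ¬ Sat M t χ → ∃ s, M.Rel w s ∧ ¬ Sat M s χ) :
    ∃ s, M.Rel w s ∧ TheoryLE Λ s t := by
  obtain ⟨y, hy, hT⟩ := hw.exists_falsifying {χ | ¬ Sat M t χ} fun T => by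
    obtain ⟨y, hy, hyT⟩ := h (.disj T (↑)) fun ht =>
      have ⟨χ, _, hχ⟩ := sat_disj.1 ht
      χ.2 hχ
    exact ⟨y, hy, fun χ hχ hyχ => hyT (sat_disj.2 ⟨χ, hχ, hyχ⟩)⟩
  exact ⟨y, hy, fun χ hyχ => not_not.1 fun htχ => hT χ htχ hyχ⟩

theorem IsModallySaturatedAt.smile_theoryLE (hv : IsModallySaturatedAt Λ M v)
    (hc : Conn.smile ∈ Λ) (h : TheoryLE Λ w v) (hs : M.Rel w s) :
    ∃ t, M.Rel v t ∧ TheoryLE Λ t s :=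
  hv.exists_theoryLE_of_not_sat fun χ hχ => h (.app .smile hc χ) ⟨s, hs, hχ⟩

theorem IsModallySaturatedAt.frown_theoryLE (hw : IsModallySaturatedAt Λ M w)
    (hc : Conn.frown ∈ Λ) (h : TheoryLE Λ w v) (ht : M.Rel v t) :
    ∃ s, M.Rel w s ∧ TheoryLE Λ t s :=
  hw.exists_theoryLE_of_sat fun χ hχ => by
    by_contra! hwχ
    exact h (.app .frown hc χ) hwχ t ht hχ

theorem IsModallySaturatedAt.circSmile_theoryLE (hw : IsModallySaturatedAt Λ M w)
    (hc : Conn.circSmile ∈ Λ) (h : TheoryLE Λ w v) (ht : M.Rel v t) :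
    TheoryLE Λ v t ∨ TheoryLE Λ v w ∧ ∃ s, M.Rel w s ∧ TheoryLE Λ s t := by
  refine or_iff_not_imp_left.2 fun hvt => ?_
  obtain ⟨φ, hvφ, htφ⟩ := exists_sat_not_sat_of_not_theoryLE hvt
  have reflects_bullet (χ : ModalFormula K Λ) (hvχ : Sat M v χ) (htχ : ¬ Sat M t χ) :
      Sat M w χ ∧ ∃ s, M.Rel w s ∧ ¬ Sat M s χ := by
    by_contra! hwχ
    exact (h (.app .circSmile hc χ) (not_or_of_imp hwχ)).elim (· hvχ) fun h => htχ (h t ht)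
  refine ⟨fun ψ hψ => (reflects_bullet (.and φ ψ) ⟨hvφ, hψ⟩ fun h => htφ h.1).1.2,
    hw.exists_theoryLE_of_not_sat fun χ hχ => ?_⟩
  obtain ⟨s, hs, hsχ⟩ := (reflects_bullet (.or φ χ) (.inl hvφ) (not_or_intro htφ hχ)).2
  exact ⟨s, hs, fun h => hsχ (.inr h)⟩

theorem IsModallySaturatedAt.circFrown_theoryLE (hw : IsModallySaturatedAt Λ M w)
    (hc : Conn.circFrown ∈ Λ) (h : TheoryLE Λ w v) (ht : M.Rel v t) :
    TheoryLE Λ t v ∨ ∃ s, M.Rel w s ∧ TheoryLE Λ t s := by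
  refine or_iff_not_imp_left.2 fun htv => ?_
  obtain ⟨φ, htφ, hvφ⟩ := exists_sat_not_sat_of_not_theoryLE htv
  refine hw.exists_theoryLE_of_sat fun χ hχ => ?_
  by_contra! hwχ
  exact (h (.app .circFrown hc (.and φ χ)) (.inr fun s hs h => hwχ s hs h.2)).elim
    (fun h => hvφ h.1) fun h => h t ht ⟨htφ, hχ⟩

theorem IsModallySaturatedAt.bulletSmile_theoryLE (hv : IsModallySaturatedAt Λ M v)
    (hc : Conn.bulletSmile ∈ Λ) (h : TheoryLE Λ w v) (hs : M.Rel w s) :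
    TheoryLE Λ w s ∨ ∃ t, M.Rel v t ∧ TheoryLE Λ t s := by
  refine or_iff_not_imp_left.2 fun hws => ?_
  obtain ⟨φ, hwφ, hsφ⟩ := exists_sat_not_sat_of_not_theoryLE hws
  refine hv.exists_theoryLE_of_not_sat fun χ hχ => ?_
  obtain ⟨t, ht, htχ⟩ := (h (.app .bulletSmile hc (.or φ χ))
    ⟨.inl hwφ, s, hs, not_or_intro hsφ hχ⟩).2
  exact ⟨t, ht, fun h => htχ (.inr h)⟩

theorem IsModallySaturatedAt.bulletFrown_theoryLE (hv : IsModallySaturatedAt Λ M v)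
    (hc : Conn.bulletFrown ∈ Λ) (h : TheoryLE Λ w v) (hs : M.Rel w s) :
    TheoryLE Λ s w ∨ TheoryLE Λ v w ∧ ∃ t, M.Rel v t ∧ TheoryLE Λ s t := by
  refine or_iff_not_imp_left.2 fun hsw => ?_
  obtain ⟨φ, hsφ, hwφ⟩ := exists_sat_not_sat_of_not_theoryLE hsw
  refine ⟨fun ψ hvψ => not_not.1 fun hwψ => ?_, hv.exists_theoryLE_of_sat fun χ hχ => ?_⟩
  · exact (h (.app .bulletFrown hc (.or φ ψ))
      ⟨not_or_intro hwφ hwψ, s, hs, .inl hsφ⟩).1 (.inr hvψ)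
  · obtain ⟨t, ht, htχ⟩ := (h (.app .bulletFrown hc (.and φ χ))
      ⟨fun h => hwφ h.1, s, hs, hsφ, hχ⟩).2
    exact ⟨t, ht, htχ.2⟩

theorem IsModallySaturated.isSimulation_theoryLE (hM : IsModallySaturated Λ M) :
    IsSimulation Λ M (TheoryLE Λ) where
  letter k _ _ h := h (.letter k)
  smile hc _ v _ := (hM v).smile_theoryLE hc
  frown hc w _ _ := (hM w).frown_theoryLE hc
  circSmile hc w _ _ := (hM w).circSmile_theoryLE hc
  circFrown hc w _ _ := (hM w).circFrown_theoryLE hc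
  bulletSmile hc _ v _ := (hM v).bulletSmile_theoryLE hc
  bulletFrown hc _ v _ := (hM v).bulletFrown_theoryLE hc

end ModalSaturation

section KripkeModels

variable {K : Type u} {Λ : Set Conn}

theorem exists_kripkeModel_toStructure_eq {W : Type v} (hW : Nonempty W)
    (str : (kripkeLanguage K).Structure W) :
    ∃ R V, (KripkeModel.mk W hW R V).toStructure = str := by
  refine ⟨fun w v => str.RelMap accSymbol ![w, v], fun k w => str.RelMap (predSymbol k) ![w],
    Structure.ext (funext fun _ => funext fun f => f.elim)
      (funext fun n => funext fun r => funext fun xs => ?_)⟩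
  cases r with
  | acc => exact congrArg (str.RelMap accSymbol) (List.ofFn_injective rfl)
  | pred k => exact congrArg (str.RelMap (predSymbol k)) (List.ofFn_injective rfl)

theorem exists_rel_realize_of_isOmegaSaturated {M : KripkeModel.{u, v} K}
    (hM : IsOmegaSaturated (kripkeLanguage K) M.World) {ι : Type*}
    (Φ : ι → (kripkeLanguage K).BoundedFormula (Fin 1) 1) (w : M.World)
    (h : ∀ s : Finset ι, ∃ y, M.Rel w y ∧ ∀ i ∈ s, (Φ i).Realize (fun _ => w) fun _ => y) :
    ∃ y, M.Rel w y ∧ ∀ i, (Φ i).Realize (fun _ => w) fun _ => y := by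
  let guarded (i : Option ι) : (kripkeLanguage K).BoundedFormula (Fin 1) 1 :=
    i.elim (accFormula (Sum.inl 0) fresh) Φ
  obtain ⟨y, hy⟩ := hM.exists_realize guarded (fun _ => w) fun s => by
    obtain ⟨y, hwy, hy⟩ := h s.eraseNone
    refine ⟨y, Option.rec (fun _ => ?_) fun i hi => hy i (Finset.mem_eraseNone.2 hi)⟩
    exact (realize_accFormula M _ _ _ _).2 hwy
  exact ⟨y, (realize_accFormula M _ _ _ _).1 (hy none), fun i => hy (some i)⟩

theorem IsOmegaSaturated.isModallySaturated {M : KripkeModel.{u, v} K}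
    (hM : IsOmegaSaturated (kripkeLanguage K) M.World) : IsModallySaturated Λ M := by
  have realize_st_fresh (χ : ModalFormula K Λ) (w y : M.World) :
      (st (fresh : Fin 1 ⊕ Fin 1) χ).Realize (fun _ => w) (fun _ => y) ↔ Sat M y χ :=
    realize_st M χ fresh _ _
  refine fun w => ⟨fun T h => ?_, fun T h => ?_⟩
  · have := exists_rel_realize_of_isOmegaSaturated hM (fun χ : T => st fresh χ.1) w
    simp only [realize_st_fresh] at this
    obtain ⟨y, hy, hT⟩ := this h
    exact ⟨y, hy, fun χ hχ => hT ⟨χ, hχ⟩⟩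
  · have := exists_rel_realize_of_isOmegaSaturated hM (fun χ : T => ∼(st fresh χ.1)) w
    simp only [BoundedFormula.realize_not, realize_st_fresh] at this
    obtain ⟨y, hy, hT⟩ := this h
    exact ⟨y, hy, fun χ hχ => hT ⟨χ, hχ⟩⟩

theorem exists_elementaryEmbedding_isOmegaSaturated (M : KripkeModel.{u, max u v} K) :
    ∃ N : KripkeModel.{u, max u v} K, Nonempty (M.World ↪ₑ[kripkeLanguage K] N.World) ∧
      IsOmegaSaturated (kripkeLanguage K) N.World := by
  have := M.nonempty
  obtain ⟨W, str, hf, hW⟩ :=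
    exists_isOmegaSaturated.{0, u, v} (L := kripkeLanguage K) M.World
  have hne : Nonempty W := hf.elim fun f => M.nonempty.map f
  obtain ⟨R, V, rfl⟩ := exists_kripkeModel_toStructure_eq hne str
  exact ⟨⟨W, hne, R, V⟩, hf, hW⟩

theorem exists_isModallySaturated (Λ : Set Conn) (M : KripkeModel.{u, max u v} K) (w : M.World) :
    ∃ (N : KripkeModel.{u, max u v} K) (w' : N.World), IsModallySaturated Λ N ∧
      ∀ α : (kripkeLanguage K).Formula Unit, Holds N α w' ↔ Holds M α w :=
  have ⟨N, ⟨f⟩, hN⟩ := exists_elementaryEmbedding_isOmegaSaturated.{u, v} M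
  ⟨N, f w, hN.isModallySaturated, fun α => f.map_formula α fun _ => w⟩

theorem exists_holds_of_finset {ι : Type w} (β : (kripkeLanguage K).Formula Unit)
    (Φ : ι → (kripkeLanguage K).Formula Unit)
    (h : ∀ s : Finset ι, ∃ (M : KripkeModel.{u, v} K) (w : M.World),
      Holds M β w ∧ ∀ i ∈ s, Holds M (Φ i) w) :
    ∃ (M : KripkeModel.{u, max w v} K) (w : M.World), Holds M β w ∧ ∀ i, Holds M (Φ i) w := by
  let Ψ (i : Option ι) : (kripkeLanguage K).Formula Unit := i.elim β Φ
  obtain ⟨W, str, hW, x, hx⟩ := exists_realize_of_finset Ψ fun s => by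
    obtain ⟨M, w, hβ, hw⟩ := h s.eraseNone
    exact ⟨M.World, inferInstance, M.nonempty, fun _ => w,
      Option.rec (fun _ => hβ) fun i hi => hw i (Finset.mem_eraseNone.2 hi)⟩
  obtain ⟨R, V, rfl⟩ := exists_kripkeModel_toStructure_eq hW str
  exact ⟨⟨W, hW, R, V⟩, x (), hx none, fun i => hx (some i)⟩

end KripkeModels

section Characterization

variable {K : Type u} {Λ : Set Conn} {α : (kripkeLanguage K).Formula Unit}

theorem preservedBySimulations_of_equivalent {φ : ModalFormula K Λ}
    (h : Equivalent.{u, v} α (st (Sum.inl ()) φ)) : PreservedBySimulations.{u, v} Λ α := by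
  intro M N S hS w w' hww' hα
  have hle : TheoryLE Λ w w' := (theoryLE_inl_inr_iff M N).1 (IsSimulation.theoryLE hS hww')
  rw [h, holds_st] at hα ⊢
  exact hle φ hα

theorem PreservedBySimulations.holds_of_theoryLE
    (h : PreservedBySimulations.{u, max u v} Λ α) {M N : KripkeModel.{u, max u v} K}
    {w : M.World} {w' : N.World} (hle : TheoryLE Λ w w') (hα : Holds M α w) : Holds N α w' := by
  obtain ⟨M', m, hM', hm⟩ := exists_isModallySaturated.{u, v} Λ M w
  obtain ⟨N', n, hN', hn⟩ := exists_isModallySaturated.{u, v} Λ N w'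
  have hle' : TheoryLE Λ m n := fun φ => by
    simpa only [← holds_st, hm, hn] using hle φ
  exact (hn α).1 (h M' N' _ (hM'.disjUnion hN').isSimulation_theoryLE m n
    ((theoryLE_inl_inr_iff M' N').2 hle') ((hm α).2 hα))

/-- The `L_Λ`-formula `φ` is a consequence of the first-order formula `α`. -/
def IsModalConsequence (α : (kripkeLanguage K).Formula Unit) (φ : ModalFormula K Λ) : Prop :=
  ∀ (M : KripkeModel.{u, v} K) (w : M.World), Holds M α w → Sat M w φ

theorem exists_holds_theoryLE {N : KripkeModel.{u, w} K} {w' : N.World}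
    (hN : ∀ φ : ModalFormula K Λ, IsModalConsequence.{u, v} α φ → Sat N w' φ) :
    ∃ (M : KripkeModel.{u, max u v} K) (w : M.World), Holds M α w ∧ TheoryLE Λ w w' := by
  let F := {φ : ModalFormula K Λ // ¬ Sat N w' φ}
  obtain ⟨M, w, hα, hw⟩ := exists_holds_of_finset.{u, v} α
    (fun φ : F => Formula.not (st (Sum.inl ()) φ.1)) fun s => by
    have hs : ¬ Sat N w' (.disj s fun φ => φ.1) := fun h =>
      have ⟨φ, _, hφ⟩ := sat_disj.1 h
      φ.2 hφ
    have := mt (hN _) hs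
    simp only [IsModalConsequence, not_forall] at this
    obtain ⟨M, w, hα, hw⟩ := this
    exact ⟨M, w, hα, fun φ hφ hwφ => hw (sat_disj.2 ⟨φ, hφ, (holds_st M φ.1 w).1 hwφ⟩)⟩
  exact ⟨M, w, hα, fun φ hφ => not_not.1 fun hn => hw ⟨φ, hn⟩ ((holds_st M φ w).2 hφ)⟩

theorem exists_equivalent_of_isModalConsequence
    (h : ∀ (M : KripkeModel.{u, max u v} K) (w : M.World),
      (∀ φ : ModalFormula K Λ, IsModalConsequence.{u, max u v} α φ → Sat M w φ) → Holds M α w) :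
    ∃ φ : ModalFormula K Λ, Equivalent.{u, max u v} α (st (Sum.inl ()) φ) := by
  let C := {φ : ModalFormula K Λ // IsModalConsequence.{u, max u v} α φ}
  obtain ⟨s, hs⟩ : ∃ s : Finset C, ∀ (M : KripkeModel.{u, max u v} K) (w : M.World),
      (∀ φ ∈ s, Sat M w φ.1) → Holds M α w := by
    by_contra! hno
    obtain ⟨M, w, hα, hw⟩ := exists_holds_of_finset.{u, max u v} (Formula.not α)
      (fun φ : C => st (Sum.inl ()) φ.1) fun s => by
      obtain ⟨M, w, hw, hα⟩ := hno s
      exact ⟨M, w, hα, fun φ hφ => (holds_st M φ.1 w).2 (hw φ hφ)⟩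
    exact hα (h M w fun φ hφ => (holds_st M φ w).1 (hw ⟨φ, hφ⟩))
  refine ⟨.conj s (↑), fun M w => ?_⟩
  rw [holds_st, sat_conj]
  exact ⟨fun hα φ _ => φ.2 M w hα, hs M w⟩

theorem PreservedBySimulations.exists_equivalent (h : PreservedBySimulations.{u, max u v} Λ α) :
    ∃ φ : ModalFormula K Λ, Equivalent.{u, max u v} α (st (Sum.inl ()) φ) :=
  exists_equivalent_of_isModalConsequence fun _ _ hN =>
    have ⟨_, _, hα, hle⟩ := exists_holds_theoryLE.{u, max u v} hN
    h.holds_of_theoryLE hle hα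

end Characterization

end Restorative

theorem theorem6p4 {K : Type u} (Λ : Set Restorative.Conn)
    (α : (Restorative.kripkeLanguage K).Formula Unit) :
    (∃ φ : Restorative.ModalFormula K Λ,
        Restorative.Equivalent.{u, max u v} α (Restorative.st (Sum.inl ()) φ)) ↔
      Restorative.PreservedBySimulations.{u, max u v} Λ α :=
  ⟨fun ⟨_, h⟩ => Restorative.preservedBySimulations_of_equivalent h, fun h => h.exists_equivalent⟩
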